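/- **Theorem 1.4.** For a non-empty finite set $A\subset\mathbb{R}$ let $\delta_A=\frac{1}{\#A}\sum_{a\in A}\delta_a$, where $\delta_a$ is the Dirac measure at $a$. Let $\{b_k\}_{k\ge1}$ and $\{N_k\}_{k\ge1}$ be sequences of positive integers with $N_k\ge b_k\ge 2$ and $b_k\mid N_k$ for every $k\ge 1$. Let $\{B_k\}_{k\ge1}$ be a sequence of nearly consecutive digit sets with respect to $\{b_k\}$ and $\{N_k\}$, that is, a sequence of finite sets of nonnegative integers such that (a) $B_k\equiv\{0,1,\dots,b_k-1\} \pmod{N_k}$ for every $k\ge1$, meaning that reduction modulo $N_k$ maps $B_k$ bijectively onto $\{0,1,\dots,b_k-1\}$ (in particular $\#B_k=b_k$), and (b) $\displaystyle\sum_{k=1}^\infty \frac{1}{b_k}\,\#\big(B_k\setminus\{0,1,\dots,b_k-1\}\big)<\infty.$ Then the infinite convolution $$\mu=\delta_{N_1^{-1}B_1}*\delta_{(N_1N_2)^{-1}B_2}*\cdots*\delta_{(N_1N_2\cdots N_n)^{-1}B_n}*\cdots$$ exists, i.e. the finite convolutions $\delta_{N_1^{-1}B_1}*\cdots*\delta_{(N_1\cdots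 N_n)^{-1}B_n}$ converge weakly, as $n\to\infty$, to a Borel probability measure $\mu$ on $\mathbb{R}$. Moreover, $\mu$ is a spectral measure: there is a countable set $\Lambda\subset\mathbb{R}$ such that the functions $x\mapsto e^{-2\pi i\lambda x}$, $\lambda\in\Lambda$, form an orthonormal basis of $L^2(\mu)$. The support of $\mu$ need not be compact: there are sequences $\{b_k\}$, $\{N_k\}$, $\{B_k\}$ satisfying all of the above for which the support of $\mu$ is not compact. -/

import Mathlib

open MeasureTheory Filter Topology
open scoped ENNReal BoundedContinuousFunction

/-- The uniform discrete probability measure `δ_A = (1 / #A) ∑_{a ∈ A} δ_a` on a finite set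
`A ⊆ ℝ`. -/
noncomputable def uniformDiscrete (A : Finset ℝ) : Measure ℝ :=
  (A.card : ℝ≥0∞)⁻¹ • ∑ a ∈ A, Measure.dirac a

/-- The finite convolution of the first `n` measures `ρ 0 ∗ ρ 1 ∗ ⋯ ∗ ρ (n - 1)`; the empty
convolution is the Dirac measure at `0`, the unit for convolution. -/
noncomputable def finiteConvolution (ρ : ℕ → Measure ℝ) : ℕ → Measure ℝ
  | 0 => Measure.dirac 0
  | n + 1 => (finiteConvolution ρ n).conv (ρ n)

/-- `μ` is the infinite convolution `ρ 0 ∗ ρ 1 ∗ ρ 2 ∗ ⋯`: it is a Borel probability measure, and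
the finite convolutions converge weakly to it. -/
def IsInfiniteConvolution (ρ : ℕ → Measure ℝ) (μ : Measure ℝ) : Prop :=
  IsProbabilityMeasure μ ∧
    ∀ f : ℝ →ᵇ ℝ,
      Tendsto (fun n => ∫ x, f x ∂(finiteConvolution ρ n)) atTop (𝓝 (∫ x, f x ∂μ))

/-- `Λ` is a spectrum of `μ`: it is countable, and the exponentials `x ↦ exp (-2πiλx)`, `λ ∈ Λ`,
form an orthonormal (Hilbert) basis of the complex space `L²(μ)`. -/
def IsSpectrum (μ : Measure ℝ) (Λ : Set ℝ) : Prop :=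
  Λ.Countable ∧
    ∃ e : HilbertBasis Λ ℂ (Lp ℂ 2 μ),
      ∀ l : Λ, (e l : ℝ → ℂ) =ᵐ[μ]
        fun x => Complex.exp (-2 * (Real.pi : ℂ) * Complex.I * ((l : ℝ) : ℂ) * (x : ℂ))

/-- A spectral measure on `ℝ`: a Borel probability measure that has a spectrum. -/
def IsSpectralMeasure (μ : Measure ℝ) : Prop :=
  IsProbabilityMeasure μ ∧ ∃ Λ : Set ℝ, IsSpectrum μ Λ

/-- The standing condition on the sequences `b` and `N`: `N k ≥ b k ≥ 2` and `b k ∣ N k`. -/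
def IsAdmissible (b N : ℕ → ℕ) : Prop :=
  ∀ k, 2 ≤ b k ∧ b k ≤ N k ∧ b k ∣ N k

/-- `B` is a sequence of nearly consecutive digit sets with respect to `b` and `N`.
The first condition is `B k ≡ {0, …, b k - 1} (mod N k)` as a congruence of digit sets: reduction
modulo `N k` is a bijection from `B k` onto `{0, …, b k - 1}` (in particular `#(B k) = b k`). -/
def IsNearlyConsecutive (b N : ℕ → ℕ) (B : ℕ → Finset ℕ) : Prop :=
  (∀ k, Set.BijOn (fun x => x % N k) (B k : Set ℕ) (Finset.range (b k) : Set ℕ)) ∧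
    Summable (fun k => (((B k) \ Finset.range (b k)).card : ℝ) / (b k : ℝ))

/-- The scaled digit set `(N 0 * N 1 * ⋯ * N k)⁻¹ B k ⊆ ℝ`. -/
noncomputable def scaledDigits (N : ℕ → ℕ) (B : ℕ → Finset ℕ) (k : ℕ) : Finset ℝ :=
  (B k).image fun x : ℕ => (∏ i ∈ Finset.range (k + 1), (N i : ℝ))⁻¹ * (x : ℝ)

/-- The sequence of measures `δ_{(N 0 ⋯ N k)⁻¹ B k}`, `k = 0, 1, 2, …`. -/
noncomputable def digitMeasure (N : ℕ → ℕ) (B : ℕ → Finset ℕ) (k : ℕ) : Measure ℝ :=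
  uniformDiscrete (scaledDigits N B k)

/-! Existence is probabilistic. Draw the `k`-th term independently from the `k`-th digit measure. A
digit outside `{0, …, b k - 1}` occurs with summable probability, so by Borel–Cantelli almost surely
all but finitely many terms are at most `1 / (N 0 ⋯ N (k-1))`. The random series converges, and its
law is `μ` (`exists_isInfiniteConvolution`).

Spectrality rests on the identity `∑ |μ̂(ξ + λ)|² = 1` for all `ξ` (`isSpectrum_of_hasSum`). At a
finite level it is algebra: the digits `B k` are distinct modulo `b k`, so the frequencies `j / b k`
form a Hadamard pair with them, and induction gives an integer spectrum of each finite convolution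
(`sum_power_finiteSpectrum`). Symmetric residues modulo `N 0 ⋯ N (n-1)` make these spectra nested
and bound the frequencies at level `n` by half that product.

The limit is taken by dominated convergence (`hasSum_of_tendsto_power`). The remaining factors of
`μ̂` must be bounded below at `ξ + λ`, uniformly in `λ`. For consecutive digits they are Dirichlet
kernels evaluated near the origin, whose product is at least `1/5`; passing to `B k` costs at most
twice the proportion of displaced digits, which is small in total for a late tail
(`le_norm_prod_mask`).

For unbounded support, one digit per level is sent far away while the moduli grow, so that the
displaced proportion stays summable. -/

/-! ### Completeness of exponentials and the Jorgensen–Pedersen criterion -/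

/-- Equality in Bessel's inequality for `x` forces every vector orthogonal to the orthonormal
family to be orthogonal to `x`. -/
lemma Orthonormal.inner_eq_zero_of_hasSum {ι E : Type*} [NormedAddCommGroup E]
    [InnerProductSpace ℂ E] {v : ι → E} (hv : Orthonormal ℂ v) {x f : E}
    (hx : HasSum (fun i => ‖inner ℂ (v i) x‖ ^ 2) (‖x‖ ^ 2))
    (hf : ∀ i, inner ℂ (v i) f = 0) : inner ℂ f x = 0 := by
  classical
  -- The projection `y` of `x` to a finite span is orthogonal to `f`, so `⟪f, x⟫ = ⟪f, x - y⟫`;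
  -- Cauchy–Schwarz and Pythagoras bound this by the Bessel defect, which tends to `0`.
  have key : ∀ s : Finset ι,
      ‖inner ℂ f x‖ ^ 2 ≤ ‖f‖ ^ 2 * (‖x‖ ^ 2 - ∑ i ∈ s, ‖inner ℂ (v i) x‖ ^ 2) := by
    intro s
    set y : E := ∑ i ∈ s, inner ℂ (v i) x • v i with hy
    have hfy : inner ℂ f y = 0 := by
      rw [hy, inner_sum]
      refine Finset.sum_eq_zero fun i _ => ?_
      rw [inner_smul_right, ← inner_conj_symm f (v i), hf i]
      simp
    have hyx : inner ℂ y x = ((∑ i ∈ s, ‖inner ℂ (v i) x‖ ^ 2 : ℝ) : ℂ) := by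
      rw [hy, sum_inner]
      push_cast
      refine Finset.sum_congr rfl fun i _ => ?_
      rw [inner_smul_left, mul_comm, RCLike.mul_conj]
      simp
    have hyy : inner ℂ y y = ((∑ i ∈ s, ‖inner ℂ (v i) x‖ ^ 2 : ℝ) : ℂ) := by
      rw [hy, hv.inner_sum]
      push_cast
      refine Finset.sum_congr rfl fun i _ => ?_
      rw [mul_comm, RCLike.mul_conj]
      simp
    have hnorm : ‖x - y‖ ^ 2 = ‖x‖ ^ 2 - ∑ i ∈ s, ‖inner ℂ (v i) x‖ ^ 2 := by
      have h1 := @norm_sub_sq ℂ E _ _ _ x y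
      have h2 : ‖y‖ ^ 2 = ∑ i ∈ s, ‖inner ℂ (v i) x‖ ^ 2 := by
        have := @norm_sq_eq_re_inner ℂ E _ _ _ y
        rw [this, hyy]
        exact Complex.ofReal_re _
      have h3 : RCLike.re (inner ℂ x y) = ∑ i ∈ s, ‖inner ℂ (v i) x‖ ^ 2 := by
        rw [inner_re_symm, hyx]
        exact Complex.ofReal_re _
      rw [h1, h2, h3]
      ring
    have : inner ℂ f x = inner ℂ f (x - y) := by rw [inner_sub_right, hfy, sub_zero]
    rw [this, ← hnorm, ← mul_pow]
    gcongr
    exact norm_inner_le_norm _ _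
  have hlim : Tendsto
      (fun s : Finset ι => ‖f‖ ^ 2 * (‖x‖ ^ 2 - ∑ i ∈ s, ‖inner ℂ (v i) x‖ ^ 2)) atTop
      (𝓝 (‖f‖ ^ 2 * (‖x‖ ^ 2 - ‖x‖ ^ 2))) := (hx.const_sub _).const_mul _
  have := ge_of_tendsto' hlim key
  rw [sub_self, mul_zero] at this
  simpa using le_antisymm this (by positivity)

/-- A real integrable function all of whose Fourier coefficients vanish is zero. -/
lemma ae_eq_zero_of_integral_exp_real {μ : Measure ℝ} [IsFiniteMeasure μ] {g : ℝ → ℝ}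
    (hg : Integrable g μ)
    (h : ∀ t : ℝ, ∫ x, (g x : ℂ) * Complex.exp (t * x * Complex.I) ∂μ = 0) : g =ᵐ[μ] 0 := by
  -- Applied to `g` and `-g`: the positive and negative parts of `g` are densities of finite
  -- measures with equal characteristic functions, hence equal measures.
  have aux : ∀ u : ℝ → ℝ, Integrable u μ → ∀ t : ℝ,
      charFun (μ.withDensity fun x => ENNReal.ofReal (u x)) t =
        ∫ x, ((max (u x) 0 : ℝ) : ℂ) * Complex.exp (t * x * Complex.I) ∂μ := by
    intro u hu t
    rw [charFun_apply_real]
    rw [integral_withDensity_eq_integral_toReal_smul₀ hu.aemeasurable.ennreal_ofReal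
      (ae_of_all _ fun x => ENNReal.ofReal_lt_top)]
    refine integral_congr_ae (ae_of_all _ fun x => ?_)
    simp [ENNReal.toReal_ofReal']
  have hfin : ∀ u : ℝ → ℝ, Integrable u μ →
      IsFiniteMeasure (μ.withDensity fun x => ENNReal.ofReal (u x)) := fun u hu =>
    isFiniteMeasure_withDensity_ofReal hu.2
  have := hfin g hg
  have := hfin (-g) hg.neg
  have hint : ∀ u : ℝ → ℝ, Integrable u μ → ∀ t : ℝ,
      Integrable (fun x => ((max (u x) 0 : ℝ) : ℂ) * Complex.exp (t * x * Complex.I)) μ := by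
    intro u hu t
    refine (hu.pos_part.ofReal).mul_bdd (c := 1) (by fun_prop) (ae_of_all _ fun x => ?_)
    rw [← Complex.ofReal_mul, Complex.norm_exp_ofReal_mul_I]
  have heq : (μ.withDensity fun x => ENNReal.ofReal (g x)) =
      μ.withDensity fun x => ENNReal.ofReal ((-g) x) := by
    refine Measure.ext_of_charFun (funext fun t => ?_)
    rw [aux g hg, aux (-g) hg.neg, ← sub_eq_zero, ← integral_sub (hint g hg t)
      (hint (-g) hg.neg t), ← h t]
    refine integral_congr_ae (ae_of_all _ fun x => ?_)
    simp only [Pi.neg_apply]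
    rw [← sub_mul, ← Complex.ofReal_sub]
    congr 2
    rcases le_total (g x) 0 with h0 | h0
    · rw [max_eq_right h0, max_eq_left (by linarith)]; ring
    · rw [max_eq_left h0, max_eq_right (by linarith)]; ring
  rw [withDensity_eq_iff_of_sigmaFinite hg.aemeasurable.ennreal_ofReal
    hg.neg.aemeasurable.ennreal_ofReal] at heq
  filter_upwards [heq] with x hx
  simp only [Pi.neg_apply] at hx
  rcases lt_trichotomy (g x) 0 with h0 | h0 | h0
  · rw [ENNReal.ofReal_of_nonpos h0.le, eq_comm, ENNReal.ofReal_eq_zero] at hx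
    linarith
  · exact h0
  · rw [ENNReal.ofReal_of_nonpos (p := -g x) (by linarith), ENNReal.ofReal_eq_zero] at hx
    linarith

/-- A complex integrable function all of whose Fourier coefficients vanish is zero. -/
lemma ae_eq_zero_of_integral_exp {μ : Measure ℝ} [IsFiniteMeasure μ] {f : ℝ → ℂ}
    (hf : Integrable f μ)
    (h : ∀ t : ℝ, ∫ x, f x * Complex.exp (t * x * Complex.I) ∂μ = 0) : f =ᵐ[μ] 0 := by
  have hint : ∀ u : ℝ → ℂ, Integrable u μ → ∀ t : ℝ,
      Integrable (fun x => u x * Complex.exp (t * x * Complex.I)) μ := by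
    intro u hu t
    refine hu.mul_bdd (c := 1) (by fun_prop) (ae_of_all _ fun x => ?_)
    rw [← Complex.ofReal_mul, Complex.norm_exp_ofReal_mul_I]
  have hconj : Integrable (fun x => (starRingEnd ℂ) (f x)) μ :=
    (Complex.conjLIE.toContinuousLinearEquiv : ℂ →L[ℝ] ℂ).integrable_comp hf
  have h' : ∀ t : ℝ, ∫ x, (starRingEnd ℂ) (f x) * Complex.exp (t * x * Complex.I) ∂μ = 0 := by
    intro t
    have := congrArg (starRingEnd ℂ) (h (-t))
    rw [← integral_conj, map_zero] at this
    rw [← this]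
    refine integral_congr_ae (ae_of_all _ fun x => ?_)
    simp [← Complex.exp_conj]
  have hre : (fun x => (f x).re) =ᵐ[μ] 0 := by
    refine ae_eq_zero_of_integral_exp_real hf.re fun t => ?_
    have := integral_add (hint f hf t) (hint _ hconj t)
    rw [h, h', add_zero] at this
    have h2 : (2 : ℂ) * ∫ x, ((f x).re : ℂ) * Complex.exp (t * x * Complex.I) ∂μ = 0 := by
      rw [← integral_const_mul, ← this]
      refine integral_congr_ae (ae_of_all _ fun x => ?_)
      simp only [Complex.re_eq_add_conj]
      ring
    simpa using h2
  have him : (fun x => (f x).im) =ᵐ[μ] 0 := by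
    refine ae_eq_zero_of_integral_exp_real hf.im fun t => ?_
    have := integral_sub (hint f hf t) (hint _ hconj t)
    rw [h, h', sub_zero] at this
    have h2 : (2 * Complex.I : ℂ) *
        ∫ x, ((f x).im : ℂ) * Complex.exp (t * x * Complex.I) ∂μ = 0 := by
      rw [← integral_const_mul, ← this]
      refine integral_congr_ae (ae_of_all _ fun x => ?_)
      simp only [Complex.im_eq_sub_conj]
      field_simp
    simpa using h2
  filter_upwards [hre, him] with x h1 h2
  exact Complex.ext h1 h2

lemma memLp_exp_character (μ : Measure ℝ) [IsFiniteMeasure μ] (l : ℝ) :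
    MemLp (fun x : ℝ => Complex.exp (-2 * (Real.pi : ℂ) * Complex.I * (l : ℂ) * (x : ℂ))) 2 μ := by
  refine MemLp.of_bound (by fun_prop) 1 (ae_of_all _ fun x => le_of_eq ?_)
  have : -2 * (Real.pi : ℂ) * Complex.I * (l : ℂ) * (x : ℂ) =
      ((-2 * Real.pi * l * x : ℝ) : ℂ) * Complex.I := by push_cast; ring
  rw [this, Complex.norm_exp_ofReal_mul_I]

/-- The exponential `x ↦ exp (-2πilx)` as an element of `L²(μ)`. -/
noncomputable def expCharacter (μ : Measure ℝ) [IsFiniteMeasure μ] (l : ℝ) : Lp ℂ 2 μ :=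
  (memLp_exp_character μ l).toLp _

lemma expCharacter_ae (μ : Measure ℝ) [IsFiniteMeasure μ] (l : ℝ) :
    (expCharacter μ l : ℝ → ℂ) =ᵐ[μ]
      fun x => Complex.exp (-2 * (Real.pi : ℂ) * Complex.I * (l : ℂ) * (x : ℂ)) :=
  (memLp_exp_character μ l).coeFn_toLp

lemma inner_expCharacter_left (μ : Measure ℝ) [IsFiniteMeasure μ] (l : ℝ) (f : Lp ℂ 2 μ) :
    inner ℂ (expCharacter μ l) f =
      ∫ x, f x * Complex.exp (((2 * Real.pi * l : ℝ) : ℂ) * x * Complex.I) ∂μ := by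
  rw [L2.inner_def]
  refine integral_congr_ae ?_
  filter_upwards [expCharacter_ae μ l] with x hx
  rw [RCLike.inner_apply, hx, ← Complex.exp_conj]
  congr 2
  simp only [map_mul, map_neg, Complex.conj_I, Complex.conj_ofReal, map_ofNat]
  push_cast
  ring

lemma inner_expCharacter (μ : Measure ℝ) [IsFiniteMeasure μ] (l l' : ℝ) :
    inner ℂ (expCharacter μ l) (expCharacter μ l') = charFun μ (2 * Real.pi * (l - l')) := by
  rw [inner_expCharacter_left, charFun_apply_real]
  refine integral_congr_ae ?_
  filter_upwards [expCharacter_ae μ l'] with x hx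
  rw [hx, ← Complex.exp_add]
  congr 1
  push_cast
  ring

/-- The Jorgensen–Pedersen criterion: if `∑_{l ∈ Λ} |μ̂(ξ + l)|² = 1` for all `ξ`, then `Λ` is a
spectrum of `μ`. -/
theorem isSpectrum_of_hasSum (μ : Measure ℝ) [IsProbabilityMeasure μ] (Λ : Set ℝ)
    (hΛ : Λ.Countable)
    (h : ∀ ξ : ℝ, HasSum (fun l : Λ => ‖charFun μ (2 * Real.pi * (ξ + l))‖ ^ 2) 1) :
    IsSpectrum μ Λ := by
  have hone : ∀ l : ℝ, inner ℂ (expCharacter μ l) (expCharacter μ l) = 1 := by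
    intro l
    rw [inner_expCharacter, sub_self, mul_zero, charFun_zero]
    simp
  have hnorm : ∀ l : ℝ, ‖expCharacter μ l‖ = 1 := by
    intro l
    have := @norm_sq_eq_re_inner ℂ _ _ _ _ (expCharacter μ l)
    rw [hone, RCLike.one_re] at this
    exact (pow_eq_one_iff_of_nonneg (norm_nonneg _) two_ne_zero).1 this
  have horth : Orthonormal ℂ fun l : Λ => expCharacter μ l := by
    refine ⟨fun l => hnorm l, fun l l' hne => ?_⟩
    change inner ℂ (expCharacter μ (l : ℝ)) (expCharacter μ (l' : ℝ)) = 0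
    rw [inner_expCharacter]
    -- At `ξ = -l'` the term of `l'` alone is already `1`, so every other term vanishes.
    have h1 := sum_le_hasSum {l, l'} (fun _ _ => by positivity) (h (-l'))
    rw [Finset.sum_pair hne, neg_add_cancel, mul_zero, charFun_zero] at h1
    simp only [probReal_univ, Complex.ofReal_one, norm_one, one_pow] at h1
    have h2 : ‖charFun μ (2 * Real.pi * (-(l' : ℝ) + l))‖ ^ 2 ≤ 0 := by linarith
    have h3 : charFun μ (2 * Real.pi * (-(l' : ℝ) + l)) = 0 := by
      simpa using le_antisymm h2 (by positivity)
    rw [← h3]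
    congr 1
    ring
  have hbot : (Submodule.span ℂ (Set.range fun l : Λ => expCharacter μ l))ᗮ = ⊥ := by
    rw [Submodule.eq_bot_iff]
    intro f hf
    have hf' : ∀ l : Λ, inner ℂ (expCharacter μ l) f = 0 := fun l =>
      (Submodule.mem_orthogonal _ f).1 hf _ (Submodule.subset_span ⟨l, rfl⟩)
    -- The hypothesis at `-ξ` is equality in Bessel's inequality for the exponential of frequency
    -- `ξ`. Thus `f` is orthogonal to all exponentials, and Fourier uniqueness gives `f = 0`.
    have hall : ∀ ξ : ℝ, inner ℂ (expCharacter μ ξ) f = 0 := by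
      intro ξ
      rw [← inner_conj_symm, horth.inner_eq_zero_of_hasSum (x := expCharacter μ ξ) (f := f) ?_ hf',
        map_zero]
      convert! h (-ξ) using 1
      · ext l
        rw [inner_expCharacter]
        congr 3
        ring
      · rw [hnorm]; norm_num
    rw [Lp.eq_zero_iff_ae_eq_zero]
    refine ae_eq_zero_of_integral_exp ((Lp.memLp f).integrable (by norm_num)) fun t => ?_
    have := hall (t / (2 * Real.pi))
    rw [inner_expCharacter_left, mul_div_cancel₀ _ (by positivity)] at this
    exact this
  refine ⟨hΛ, HilbertBasis.mkOfOrthogonalEqBot horth hbot, fun l => ?_⟩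
  rw [HilbertBasis.coe_mkOfOrthogonalEqBot]
  exact expCharacter_ae μ l

/-! ### Existence of infinite convolutions -/

open ProbabilityTheory in
/-- The finite convolutions are the laws of the partial sums of independent coordinates. -/
lemma finiteConvolution_eq_map (ρ : ℕ → Measure ℝ) [∀ k, IsProbabilityMeasure (ρ k)] (n : ℕ) :
    finiteConvolution ρ n =
      (Measure.infinitePi ρ).map fun ω => ∑ k ∈ Finset.range n, ω k := by
  induction n with
  | zero => simp [finiteConvolution, Measure.map_const]
  | succ n ih =>
    have hind : iIndepFun (fun (k : ℕ) (ω : ℕ → ℝ) => ω k) (Measure.infinitePi ρ) :=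
      iIndepFun_infinitePi (X := fun _ x => x) (fun _ => measurable_id)
    have h1 := hind.indepFun_finsetSum_of_notMem (fun k => measurable_pi_apply k)
      (s := Finset.range n) (i := n) (by simp)
    have h2 := h1.map_add_eq_map_conv_map (by fun_prop) (measurable_pi_apply n)
    have h3 : (fun ω : ℕ → ℝ => ∑ k ∈ Finset.range (n + 1), ω k) =
        (∑ k ∈ Finset.range n, fun ω : ℕ → ℝ => ω k) + fun ω => ω n := by
      ext ω
      simp [Finset.sum_range_succ]
    have h4 : (∑ k ∈ Finset.range n, fun ω : ℕ → ℝ => ω k) =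
        fun ω => ∑ k ∈ Finset.range n, ω k := by
      ext ω
      simp
    rw [h3, h2, h4, ← ih, Measure.infinitePi_map_eval]
    rfl

/-- A sequence of probability measures, whose mass outside `[-c k, c k]` is summable for some
summable `c`, has an infinite convolution. If the measures live on the nonnegative reals, then the
tails of the infinite convolution dominate those of each factor. -/
theorem exists_isInfiniteConvolution (ρ : ℕ → Measure ℝ) [∀ k, IsProbabilityMeasure (ρ k)]
    (c : ℕ → ℝ) (hc : Summable c) (hρ : ∑' k, ρ k {x | c k < |x|} ≠ ∞) :
    ∃ μ : Measure ℝ, IsInfiniteConvolution ρ μ ∧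
      ((∀ k, ∀ᵐ x ∂ρ k, 0 ≤ x) → ∀ (k : ℕ) (R : ℝ), ρ k (Set.Ici R) ≤ μ (Set.Ici R)) := by
  set P := Measure.infinitePi ρ with hP
  have hmp : ∀ k, MeasurePreserving (fun ω : ℕ → ℝ => ω k) P (ρ k) := fun k =>
    measurePreserving_eval_infinitePi ρ k
  have hsum : ∀ᵐ ω ∂P, Summable ω := by
    have hm : ∀ k, MeasurableSet {x : ℝ | c k < |x|} := fun k =>
      measurableSet_lt measurable_const continuous_abs.measurable
    -- Borel–Cantelli: almost surely `|ω k| ≤ c k` for all large `k`.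
    have h1 : ∑' k, P ((fun ω : ℕ → ℝ => ω k) ⁻¹' {x | c k < |x|}) ≠ ∞ := by
      simpa only [(hmp _).measure_preimage (hm _).nullMeasurableSet] using hρ
    filter_upwards [ae_eventually_notMem h1] with ω hω
    refine Summable.of_norm_bounded_eventually_nat hc ?_
    filter_upwards [hω] with k hk
    simpa using hk
  have htend : ∀ᵐ ω ∂P, Tendsto (fun n => ∑ k ∈ Finset.range n, ω k) atTop (𝓝 (∑' k, ω k)) := by
    filter_upwards [hsum] with ω hω using hω.hasSum.tendsto_sum_nat
  have hmeas : AEMeasurable (fun ω : ℕ → ℝ => ∑' k, ω k) P :=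
    aemeasurable_of_tendsto_metrizable_ae atTop (fun n => by fun_prop) htend
  refine ⟨P.map fun ω => ∑' k, ω k, ⟨Measure.isProbabilityMeasure_map hmeas, fun f => ?_⟩, ?_⟩
  · rw [integral_map hmeas (by fun_prop)]
    have : ∀ n, ∫ x, f x ∂finiteConvolution ρ n = ∫ ω, f (∑ k ∈ Finset.range n, ω k) ∂P := by
      intro n
      rw [finiteConvolution_eq_map, integral_map (by fun_prop) (by fun_prop)]
    simp only [this]
    refine tendsto_integral_of_dominated_convergence (fun _ => ‖f‖) (fun n => ?_)
      (integrable_const _) (fun n => ae_of_all _ fun ω => f.norm_coe_le_norm _) ?_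
    · exact (f.continuous.measurable.comp (by fun_prop)).aestronglyMeasurable
    · filter_upwards [htend] with ω hω using (f.continuous.tendsto _).comp hω
  · intro hpos k R
    rw [Measure.map_apply_of_aemeasurable hmeas measurableSet_Ici,
      ← (hmp k).measure_preimage measurableSet_Ici.nullMeasurableSet]
    have hpos' : ∀ᵐ ω ∂P, ∀ j, 0 ≤ ω j :=
      ae_all_iff.2 fun j => (hmp j).quasiMeasurePreserving.ae (hpos j)
    refine measure_mono_ae ?_
    filter_upwards [hsum, hpos'] with ω h1 h2 h3
    exact le_trans h3 (h1.le_tsum k fun j _ => h2 j)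

/-! ### Exponential sums of digit sets -/

/-- The normalised exponential sum of a digit set `A`. -/
noncomputable def digitSum (A : Finset ℕ) (t : ℝ) : ℂ :=
  (A.card : ℂ)⁻¹ * ∑ x ∈ A, Complex.exp ((2 * Real.pi * t * x : ℝ) * Complex.I)

lemma digitSum_zero {A : Finset ℕ} (hA : A.card ≠ 0) : digitSum A 0 = 1 := by
  simp [digitSum, hA]

lemma norm_digitSum_le_one (A : Finset ℕ) (t : ℝ) : ‖digitSum A t‖ ≤ 1 := by
  rw [digitSum, norm_mul, norm_inv, Complex.norm_natCast]
  have : ‖∑ x ∈ A, Complex.exp ((2 * Real.pi * t * x : ℝ) * Complex.I)‖ ≤ A.card := by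
    refine (norm_sum_le _ _).trans ?_
    simp only [Complex.norm_exp_ofReal_mul_I]
    simp
  calc (A.card : ℝ)⁻¹ * _ ≤ (A.card : ℝ)⁻¹ * A.card := by gcongr
    _ ≤ 1 := inv_mul_le_one

lemma digitSum_add_int (A : Finset ℕ) (t : ℝ) (z : ℤ) : digitSum A (t + z) = digitSum A t := by
  unfold digitSum
  congr 1
  refine Finset.sum_congr rfl fun x _ => ?_
  rw [Complex.exp_eq_exp_iff_exists_int]
  refine ⟨z * x, ?_⟩
  push_cast
  ring

/-- The Hadamard property of a digit set that is injective modulo its cardinality. -/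
lemma sum_norm_digitSum_sq {A : Finset ℕ} {b : ℕ} (hb : 0 < b) (hA : A.card = b)
    (hinj : Set.InjOn (fun x => x % b) (A : Set ℕ)) (t : ℝ) :
    ∑ j ∈ Finset.range b, ‖digitSum A (t + j / b)‖ ^ 2 = 1 := by
  have hb' : (b : ℂ) ≠ 0 := by exact_mod_cast hb.ne'
  -- The ratio is a `b`-th root of unity, and it equals `1` only if `x ≡ y` modulo `b`.
  have hgeom : ∀ x ∈ A, ∀ y ∈ A,
      ∑ j ∈ Finset.range b, Complex.exp (2 * Real.pi * Complex.I * (((x : ℂ) - y) / b)) ^ j =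
        if x = y then (b : ℂ) else 0 := by
    intro x hx y hy
    split_ifs with hxy
    · simp [hxy]
    · have hne : Complex.exp (2 * Real.pi * Complex.I * (((x : ℂ) - y) / b)) ≠ 1 := by
        intro h1
        obtain ⟨n, hn⟩ := Complex.exp_eq_one_iff.1 h1
        have h2 : ((x : ℂ) - y) / b = n := by
          have := Complex.two_pi_I_ne_zero
          apply mul_left_cancel₀ this
          rw [hn]; ring
        rw [div_eq_iff hb'] at h2
        have h3 : (x : ℤ) - y = n * b := by exact_mod_cast h2
        refine hxy (hinj hx hy ?_)
        have : (y : ℤ) ≡ x [ZMOD b] := (Int.modEq_iff_dvd.2 ⟨n, by rw [h3]; ring⟩)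
        exact ((Int.natCast_modEq_iff.1 this).symm : x % b = y % b)
      rw [geom_sum_eq hne, ← Complex.exp_nat_mul]
      have : Complex.exp (b * (2 * Real.pi * Complex.I * (((x : ℂ) - y) / b))) = 1 := by
        rw [Complex.exp_eq_one_iff]
        refine ⟨(x : ℤ) - y, ?_⟩
        push_cast
        field_simp
      rw [this, sub_self, zero_div]
  have hterm : ∀ j : ℕ, ((‖digitSum A (t + j / b)‖ ^ 2 : ℝ) : ℂ) =
      ((b : ℂ)⁻¹ * (b : ℂ)⁻¹) * ∑ x ∈ A, ∑ y ∈ A,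
        Complex.exp (2 * Real.pi * t * ((x : ℂ) - y) * Complex.I) *
          Complex.exp (2 * Real.pi * Complex.I * (((x : ℂ) - y) / b)) ^ j := by
    intro j
    have h := Complex.mul_conj' (digitSum A (t + j / b))
    push_cast at h ⊢
    rw [← h, digitSum, map_mul, map_sum, map_inv₀, map_natCast, hA, mul_mul_mul_comm,
      Finset.sum_mul_sum]
    congr 1
    refine Finset.sum_congr rfl fun x _ => Finset.sum_congr rfl fun y _ => ?_
    rw [← Complex.exp_conj, ← Complex.exp_add, ← Complex.exp_nat_mul, ← Complex.exp_add]
    congr 1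
    simp only [map_mul, Complex.conj_I, Complex.conj_ofReal]
    push_cast
    ring
  have : ((∑ j ∈ Finset.range b, ‖digitSum A (t + j / b)‖ ^ 2 : ℝ) : ℂ) = 1 := by
    rw [Complex.ofReal_sum, Finset.sum_congr rfl fun j _ => hterm j, ← Finset.mul_sum,
      Finset.sum_comm]
    have h1 : ∀ x ∈ A, ∑ j ∈ Finset.range b, ∑ y ∈ A,
        Complex.exp (2 * Real.pi * t * ((x : ℂ) - y) * Complex.I) *
          Complex.exp (2 * Real.pi * Complex.I * (((x : ℂ) - y) / b)) ^ j = b := by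
      intro x hx
      rw [Finset.sum_comm]
      have h2 : ∀ y ∈ A, ∑ j ∈ Finset.range b,
          Complex.exp (2 * Real.pi * t * ((x : ℂ) - y) * Complex.I) *
            Complex.exp (2 * Real.pi * Complex.I * (((x : ℂ) - y) / b)) ^ j =
          if x = y then (b : ℂ) else 0 := by
        intro y hy
        rw [← Finset.mul_sum, hgeom x hx y hy]
        split_ifs with hxy
        · simp [hxy]
        · simp
      rw [Finset.sum_congr rfl h2]
      simp [hx]
    rw [Finset.sum_congr rfl h1, Finset.sum_const, hA, nsmul_eq_mul]
    field_simp
  exact_mod_cast this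

lemma sum_range_two_mul_sub_sq (n : ℕ) (c : ℝ) :
    ∑ j ∈ Finset.range n, (2 * (j : ℝ) - c) ^ 2 =
      2 * (n * (n - 1) * (2 * n - 1)) / 3 - 2 * c * (n * (n - 1)) + n * c ^ 2 := by
  induction n with
  | zero => simp
  | succ n ih => rw [Finset.sum_range_succ, ih]; push_cast; ring

/-- A lower bound near the origin for the Dirichlet kernel. -/
lemma one_sub_le_norm_digitSum_range {b : ℕ} (hb : 0 < b) (t : ℝ) :
    1 - Real.pi ^ 2 * (b * t) ^ 2 / 6 ≤ ‖digitSum (Finset.range b) t‖ := by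
  have hb' : (0 : ℝ) < b := by exact_mod_cast hb
  -- The unimodular `w` centres the phases symmetrically about `0`, so that the cosine bound loses
  -- only a quadratic term.
  set w : ℂ := Complex.exp ((-(Real.pi * t * (b - 1)) : ℝ) * Complex.I) with hw
  have hwn : ‖w‖ = 1 := Complex.norm_exp_ofReal_mul_I _
  have hre : (w * digitSum (Finset.range b) t).re =
      (b : ℝ)⁻¹ * ∑ j ∈ Finset.range b, Real.cos (Real.pi * t * (2 * j - (b - 1))) := by
    have : w * digitSum (Finset.range b) t = ((b : ℝ)⁻¹ : ℝ) * ∑ j ∈ Finset.range b,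
        Complex.exp ((Real.pi * t * (2 * j - (b - 1)) : ℝ) * Complex.I) := by
      rw [digitSum, mul_left_comm, Finset.card_range, Finset.mul_sum]
      push_cast
      congr 1
      refine Finset.sum_congr rfl fun j _ => ?_
      rw [hw, ← Complex.exp_add]
      congr 1
      push_cast
      ring
    rw [this, Complex.re_ofReal_mul, Complex.re_sum]
    congr 1
    exact Finset.sum_congr rfl fun j _ => Complex.exp_ofReal_mul_I_re _
  calc 1 - Real.pi ^ 2 * (b * t) ^ 2 / 6
      ≤ (b : ℝ)⁻¹ * ∑ j ∈ Finset.range b, (1 - (Real.pi * t * (2 * j - (b - 1))) ^ 2 / 2) := by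
        have : ∑ j ∈ Finset.range b, (1 - (Real.pi * t * (2 * (j : ℝ) - (b - 1))) ^ 2 / 2) =
            b - (Real.pi * t) ^ 2 / 2 *
              ∑ j ∈ Finset.range b, (2 * (j : ℝ) - (b - 1)) ^ 2 := by
          rw [Finset.sum_sub_distrib, Finset.mul_sum]
          congr 1
          · simp
          · exact Finset.sum_congr rfl fun j _ => by ring
        rw [this, sum_range_two_mul_sub_sq]
        -- The exact quadratic coefficient carries `b ^ 2 - 1`; the surplus is nonnegative and is
        -- dropped.
        have h2 : (b : ℝ)⁻¹ * (b - (Real.pi * t) ^ 2 / 2 * (2 * (b * (b - 1) * (2 * b - 1)) / 3 -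
            2 * (b - 1) * (b * (b - 1)) + b * (b - 1) ^ 2)) =
            1 - Real.pi ^ 2 * (b * t) ^ 2 / 6 + Real.pi ^ 2 * t ^ 2 / 6 := by
          field_simp
          ring
        rw [h2]
        linarith [show 0 ≤ Real.pi ^ 2 * t ^ 2 / 6 by positivity]
    _ ≤ (b : ℝ)⁻¹ * ∑ j ∈ Finset.range b, Real.cos (Real.pi * t * (2 * j - (b - 1))) := by
        gcongr with j
        exact Real.one_sub_sq_div_two_le_cos
    _ = (w * digitSum (Finset.range b) t).re := hre.symm
    _ ≤ ‖w * digitSum (Finset.range b) t‖ := Complex.re_le_norm _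
    _ = ‖digitSum (Finset.range b) t‖ := by rw [norm_mul, hwn, one_mul]

/-- Common digits cancel, and the digits removed are as many as those added, whence the factor `2`.
-/
lemma norm_digitSum_sub_range_le {A : Finset ℕ} {b : ℕ} (hA : A.card = b) (t : ℝ) :
    ‖digitSum A t - digitSum (Finset.range b) t‖ ≤
      2 * (((A \ Finset.range b).card : ℝ) / b) := by
  have hbd : ∀ S : Finset ℕ,
      ‖∑ x ∈ S, Complex.exp ((2 * Real.pi * t * x : ℝ) * Complex.I)‖ ≤ S.card := by
    intro S
    refine (norm_sum_le _ _).trans ?_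
    simp only [Complex.norm_exp_ofReal_mul_I]
    simp
  have hcard : (Finset.range b \ A).card = (A \ Finset.range b).card :=
    Finset.card_sdiff_comm (by simp [hA])
  rw [digitSum, digitSum, hA, Finset.card_range, ← mul_sub, ← Finset.sum_sdiff_sub_sum_sdiff,
    norm_mul, norm_inv, Complex.norm_natCast]
  have := (norm_sub_le _ _).trans (add_le_add (hbd (A \ Finset.range b)) (hbd (Finset.range b \ A)))
  rw [hcard] at this
  calc _ ≤ (b : ℝ)⁻¹ * (((A \ Finset.range b).card : ℝ) + (A \ Finset.range b).card) := by gcongr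
    _ = _ := by ring

lemma norm_prod_sub_prod_le {ι : Type*} (s : Finset ι) (f g : ι → ℂ)
    (hf : ∀ i, ‖f i‖ ≤ 1) (hg : ∀ i, ‖g i‖ ≤ 1) :
    ‖∏ i ∈ s, f i - ∏ i ∈ s, g i‖ ≤ ∑ i ∈ s, ‖f i - g i‖ := by
  classical
  induction s using Finset.induction_on with
  | empty => simp
  | insert a s ha ih =>
    rw [Finset.prod_insert ha, Finset.prod_insert ha, Finset.sum_insert ha]
    have h1 : f a * ∏ i ∈ s, f i - g a * ∏ i ∈ s, g i =
        (f a - g a) * ∏ i ∈ s, f i + g a * (∏ i ∈ s, f i - ∏ i ∈ s, g i) := by ring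
    have h2 : ‖∏ i ∈ s, f i‖ ≤ 1 := by
      rw [norm_prod]
      exact Finset.prod_le_one (fun _ _ => norm_nonneg _) fun i _ => hf i
    rw [h1]
    refine (norm_add_le _ _).trans ?_
    rw [norm_mul, norm_mul]
    refine add_le_add (mul_le_of_le_one_right (norm_nonneg _) h2) ?_
    exact (mul_le_of_le_one_left (norm_nonneg _) (hg a)).trans ih

/-- Weierstrass product inequality, by induction from `(1 - f i) * (1 - ∏ f) ≥ 0`. -/
lemma one_sub_sum_le_prod {ι : Type*} (s : Finset ι) (f a : ι → ℝ)
    (hf0 : ∀ i, 0 ≤ f i) (hf1 : ∀ i, f i ≤ 1) (h : ∀ i ∈ s, 1 - a i ≤ f i) :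
    1 - ∑ i ∈ s, a i ≤ ∏ i ∈ s, f i := by
  classical
  induction s using Finset.induction_on with
  | empty => simp
  | insert i s hi ih =>
    rw [Finset.prod_insert hi, Finset.sum_insert hi]
    have h1 := ih fun j hj => h j (Finset.mem_insert_of_mem hj)
    have h2 := h i (Finset.mem_insert_self _ _)
    have h3 : ∏ j ∈ s, f j ≤ 1 := Finset.prod_le_one (fun j _ => hf0 j) fun j _ => hf1 j
    have h4 : 0 ≤ ∏ j ∈ s, f j := Finset.prod_nonneg fun j _ => hf0 j
    nlinarith [mul_nonneg (sub_nonneg.2 (hf1 i)) (sub_nonneg.2 h3)]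

/-! ### Masks and spectra of the finite convolutions -/

/-- The product `N 0 * ⋯ * N (n - 1)`. -/
def scale (N : ℕ → ℕ) (n : ℕ) : ℕ := ∏ i ∈ Finset.range n, N i

lemma scale_succ (N : ℕ → ℕ) (n : ℕ) : scale N (n + 1) = scale N n * N n :=
  Finset.prod_range_succ _ _

lemma scale_dvd (N : ℕ → ℕ) {m n : ℕ} (h : m ≤ n) : scale N m ∣ scale N n :=
  Finset.prod_dvd_prod_of_subset _ _ _ (by simpa using h)

lemma scale_pos {N : ℕ → ℕ} (hN : ∀ k, 2 ≤ N k) (n : ℕ) : 0 < scale N n :=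
  Finset.prod_pos fun k _ => by have := hN k; omega

lemma two_pow_mul_scale_le {N : ℕ → ℕ} (hN : ∀ k, 2 ≤ N k) (n k : ℕ) :
    2 ^ k * scale N n ≤ scale N (n + k) := by
  induction k with
  | zero => simp
  | succ k ih =>
    rw [← add_assoc, scale_succ, pow_succ]
    calc 2 ^ k * 2 * scale N n = (2 ^ k * scale N n) * 2 := by ring
      _ ≤ _ := Nat.mul_le_mul ih (hN _)

/-- The Fourier transform, at frequency `ξ`, of the `k`-th factor of the convolution. -/
noncomputable def mask (N : ℕ → ℕ) (B : ℕ → Finset ℕ) (k : ℕ) (ξ : ℝ) : ℂ :=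
  digitSum (B k) (ξ / scale N (k + 1))

lemma mask_add_int {N : ℕ → ℕ} (hN : ∀ k, 2 ≤ N k) (B : ℕ → Finset ℕ) {k n : ℕ} (hk : k < n)
    (ξ : ℝ) (z : ℤ) : mask N B k (ξ + scale N n * z) = mask N B k ξ := by
  obtain ⟨d, hd⟩ := scale_dvd N (Nat.succ_le_of_lt hk)
  have h0 : (scale N (k + 1) : ℝ) ≠ 0 := by exact_mod_cast (scale_pos hN _).ne'
  rw [mask, mask, ← digitSum_add_int (B k) (ξ / scale N (k + 1)) (d * z)]
  congr 1
  rw [hd]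
  push_cast
  field_simp

/-- The squared modulus of the Fourier transform of the `n`-th finite convolution. -/
noncomputable def power (N : ℕ → ℕ) (B : ℕ → Finset ℕ) (n : ℕ) (ξ : ℝ) : ℝ :=
  ∏ k ∈ Finset.range n, ‖mask N B k ξ‖ ^ 2

lemma power_nonneg (N : ℕ → ℕ) (B : ℕ → Finset ℕ) (n : ℕ) (ξ : ℝ) : 0 ≤ power N B n ξ :=
  Finset.prod_nonneg fun _ _ => by positivity

lemma power_zero_right {N : ℕ → ℕ} {B : ℕ → Finset ℕ} (hB : ∀ k, (B k).card ≠ 0) (n : ℕ) :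
    power N B n 0 = 1 :=
  Finset.prod_eq_one fun k _ => by simp [mask, digitSum_zero (hB k)]

lemma power_add_int {N : ℕ → ℕ} (hN : ∀ k, 2 ≤ N k) (B : ℕ → Finset ℕ) (n : ℕ)
    (ξ : ℝ) (z : ℤ) : power N B n (ξ + scale N n * z) = power N B n ξ :=
  Finset.prod_congr rfl fun k hk => by rw [mask_add_int hN B (Finset.mem_range.1 hk)]

/-- The symmetric residue that represents the frequency `p.1 + (N 0 ⋯ N (n-1)) (N n / b n) p.2`
modulo `N 0 ⋯ N n`. -/
def nextFrequency (b N : ℕ → ℕ) (n : ℕ) (p : ℤ × ℕ) : ℤ :=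
  Int.bmod (p.1 + scale N n * (N n / b n : ℕ) * p.2) (scale N (n + 1))

/-- An increasing sequence of spectra of the finite convolutions. -/
def finiteSpectrum (b N : ℕ → ℕ) : ℕ → Finset ℤ
  | 0 => {0}
  | n + 1 => (finiteSpectrum b N n ×ˢ Finset.range (b n)).image (nextFrequency b N n)

lemma two_mul_abs_le_of_mem_finiteSpectrum {b N : ℕ → ℕ} (hN : ∀ k, 2 ≤ N k) {n : ℕ} {l : ℤ}
    (hl : l ∈ finiteSpectrum b N n) : 2 * |l| ≤ scale N n := by
  cases n with
  | zero =>
    have : l = 0 := by simpa [finiteSpectrum] using hl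
    simp [this]
  | succ n =>
    obtain ⟨p, -, rfl⟩ := Finset.mem_image.1 hl
    have h1 := Int.le_bmod (x := p.1 + scale N n * (N n / b n : ℕ) * p.2) (scale_pos hN (n + 1))
    have h2 := Int.bmod_lt (x := p.1 + scale N n * (N n / b n : ℕ) * p.2) (scale_pos hN (n + 1))
    change 2 * |Int.bmod _ _| ≤ _
    rw [abs_eq_max_neg]
    omega

/-- The choice `j = 0` keeps `l`: it is already its own symmetric residue at the next level, since
the scale at least doubles. -/
lemma finiteSpectrum_subset_succ {b N : ℕ → ℕ} (hb : ∀ k, 0 < b k) (hN : ∀ k, 2 ≤ N k) (n : ℕ) :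
    finiteSpectrum b N n ⊆ finiteSpectrum b N (n + 1) := by
  intro l hl
  refine Finset.mem_image.2 ⟨(l, 0), by simp [hl, hb n], ?_⟩
  have h1 := two_mul_abs_le_of_mem_finiteSpectrum hN hl
  have h2 : 2 * scale N n ≤ scale N (n + 1) := by simpa using two_pow_mul_scale_le hN n 1
  have h3 := scale_pos hN n
  rw [abs_eq_max_neg] at h1
  simp only [nextFrequency, Nat.cast_zero, mul_zero, add_zero]
  exact Int.bmod_eq_of_le_mul_two (by omega) (by omega)

lemma finiteSpectrum_mono {b N : ℕ → ℕ} (hb : ∀ k, 0 < b k) (hN : ∀ k, 2 ≤ N k) :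
    Monotone (finiteSpectrum b N) :=
  monotone_nat_of_le_succ fun n => finiteSpectrum_subset_succ hb hN n

/-- `finiteSpectrum b N n` is a spectrum of the `n`-th finite convolution. -/
lemma sum_power_finiteSpectrum {b N : ℕ → ℕ} {B : ℕ → Finset ℕ} (hb : ∀ k, 0 < b k)
    (hN : ∀ k, 2 ≤ N k) (hbN : ∀ k, b k ∣ N k) (hB : ∀ k, (B k).card = b k)
    (hinj : ∀ k, Set.InjOn (fun x => x % b k) (B k : Set ℕ)) (n : ℕ) (ξ : ℝ) :
    ∑ l ∈ finiteSpectrum b N n, power N B n (ξ + l) = 1 := by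
  induction n generalizing ξ with
  | zero => simp [finiteSpectrum, power]
  | succ n ih =>
    have hpair : ∀ ξ : ℝ, ∑ p ∈ finiteSpectrum b N n ×ˢ Finset.range (b n),
        power N B (n + 1) (ξ + nextFrequency b N n p) = 1 := by
      intro ξ
      have hterm : ∀ (l : ℤ) (j : ℕ), power N B (n + 1) (ξ + nextFrequency b N n (l, j)) =
          power N B n (ξ + l) * ‖digitSum (B n) ((ξ + l) / scale N (n + 1) + j / b n)‖ ^ 2 := by
        intro l j
        -- Reduction to the symmetric residue shifts by a multiple of `scale N (n + 1)`, invisible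
        -- to all `n + 1` masks; the shift by `scale N n * (N n / b n) * j` is seen only by the last
        -- one, as `j / b n`.
        have h1 : ξ + nextFrequency b N n (l, j) = ξ + l + scale N n * ((N n / b n : ℕ) * j : ℤ) +
            scale N (n + 1) *
            ((-Int.bdiv (l + scale N n * (N n / b n : ℕ) * j) (scale N (n + 1)) : ℤ) : ℝ) := by
          rw [nextFrequency, Int.bmod_eq_self_sub_mul_bdiv]
          push_cast
          ring
        rw [h1, power_add_int hN]
        have h2 : power N B (n + 1) (ξ + l + scale N n * ((N n / b n : ℕ) * j : ℤ)) =
            power N B n (ξ + l + scale N n * ((N n / b n : ℕ) * j : ℤ)) *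
              ‖mask N B n (ξ + l + scale N n * ((N n / b n : ℕ) * j : ℤ))‖ ^ 2 :=
          Finset.prod_range_succ _ _
        have h3 := power_add_int hN B n (ξ + l) ((N n / b n : ℕ) * j : ℤ)
        push_cast at h2 h3 ⊢
        rw [h2, h3]
        congr 3
        rw [mask]
        congr 1
        have hs : (scale N n : ℝ) ≠ 0 := by exact_mod_cast (scale_pos hN n).ne'
        have hb0 : (b n : ℝ) ≠ 0 := by exact_mod_cast (hb n).ne'
        have hN0 : (N n : ℝ) ≠ 0 := by have := hN n; positivity
        have hq : (((N n : ℤ) / (b n : ℤ) : ℤ) : ℝ) = N n / b n := by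
          rw [Int.cast_div (by exact_mod_cast hbN n) (by exact_mod_cast hb0)]
          simp
        rw [scale_succ, hq]
        push_cast
        field_simp
      rw [Finset.sum_product]
      simp only [hterm, ← Finset.mul_sum]
      rw [← ih ξ]
      refine Finset.sum_congr rfl fun l _ => ?_
      rw [sum_norm_digitSum_sq (hb n) (hB n) (hinj n), mul_one]
    -- Two pairs with a common frequency `λ` would each contribute `power 0 = 1` to the sum at `ξ =
    -- -λ`, which equals `1`.
    have hinj' : Set.InjOn (nextFrequency b N n)
        (finiteSpectrum b N n ×ˢ Finset.range (b n) : Finset (ℤ × ℕ)) := by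
      intro p hp q hq hpq
      by_contra hne
      have h1 := hpair (-(nextFrequency b N n p))
      have h2 : ∑ r ∈ {p, q}, power N B (n + 1)
          (-(nextFrequency b N n p : ℝ) + nextFrequency b N n r) ≤ 1 := by
        rw [← h1]
        refine Finset.sum_le_sum_of_subset_of_nonneg ?_ fun _ _ _ => power_nonneg _ _ _ _
        intro r hr
        rcases Finset.mem_insert.1 hr with rfl | hr
        · exact hp
        · rw [Finset.mem_singleton.1 hr]; exact hq
      rw [Finset.sum_pair hne, ← hpq, neg_add_cancel,
        power_zero_right fun k => by rw [hB]; exact (hb k).ne'] at h2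
      norm_num at h2
    rw [finiteSpectrum, Finset.sum_image hinj']
    exact hpair ξ

/-! ### Uniform tail bound and passage to the limit -/

/-- The Fourier transforms of the tails of the convolution are bounded away from zero near the
origin, uniformly in the starting point of the tail. -/
lemma le_norm_prod_mask {b N : ℕ → ℕ} {B : ℕ → Finset ℕ} (hb : ∀ k, 0 < b k)
    (hN : ∀ k, 2 ≤ N k) (hbN : ∀ k, b k ≤ N k) (hB : ∀ k, (B k).card = b k) (n j : ℕ) {t : ℝ}
    (ht : |t| ≤ 3 / 5 * scale N n) :
    1 / 5 - ∑ i ∈ Finset.range j,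
        2 * (((B (n + i) \ Finset.range (b (n + i))).card : ℝ) / b (n + i)) ≤
      ‖∏ i ∈ Finset.range j, mask N B (n + i) t‖ := by
  set D : ℕ → ℂ := fun i =>
    digitSum (Finset.range (b (n + i))) (t / scale N (n + i + 1)) with hD
  have hclose : ‖∏ i ∈ Finset.range j, mask N B (n + i) t - ∏ i ∈ Finset.range j, D i‖ ≤
      ∑ i ∈ Finset.range j,
        2 * (((B (n + i) \ Finset.range (b (n + i))).card : ℝ) / b (n + i)) :=
    (norm_prod_sub_prod_le _ _ _ (fun i => norm_digitSum_le_one _ _)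
      fun i => norm_digitSum_le_one _ _).trans
      (Finset.sum_le_sum fun i _ => norm_digitSum_sub_range_le (hB _) _)
  -- With `π² ≤ 10` the defect is at most `10 * (9 / 25) / 6 = 3 / 5` times `(1 / 4) ^ i`. These sum
  -- to at most `4 / 5`, leaving `1 / 5`.
  have hfac : ∀ i, 1 - 3 / 5 * (1 / 4 : ℝ) ^ i ≤ ‖D i‖ := by
    intro i
    refine le_trans ?_ (one_sub_le_norm_digitSum_range (hb (n + i)) _)
    have hs : (0 : ℝ) < scale N (n + i) := by exact_mod_cast scale_pos hN _
    have hs1 : (0 : ℝ) < scale N (n + i + 1) := by exact_mod_cast scale_pos hN _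
    have h1 : |(b (n + i) : ℝ) * (t / scale N (n + i + 1))| ≤ 3 / 5 * (1 / 2) ^ i := by
      rw [abs_mul, abs_div, Nat.abs_cast, abs_of_pos hs1, ← mul_div_assoc, div_le_iff₀ hs1]
      have h2 : (2 : ℝ) ^ i * scale N n ≤ scale N (n + i) := by
        exact_mod_cast two_pow_mul_scale_le hN n i
      have h3 : (scale N (n + i + 1) : ℝ) = scale N (n + i) * N (n + i) := by
        exact_mod_cast scale_succ N (n + i)
      have h4 : (b (n + i) : ℝ) ≤ N (n + i) := by exact_mod_cast hbN _
      rw [h3]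
      calc (b (n + i) : ℝ) * |t| ≤ N (n + i) * (3 / 5 * scale N n) := by gcongr
        _ = 3 / 5 * (1 / 2) ^ i * (2 ^ i * scale N n * N (n + i)) := by
            rw [one_div, inv_pow]; field_simp
        _ ≤ 3 / 5 * (1 / 2) ^ i * (scale N (n + i) * N (n + i)) := by gcongr
    have h5 : ((b (n + i) : ℝ) * (t / scale N (n + i + 1))) ^ 2 ≤ 9 / 25 * (1 / 4) ^ i := by
      rw [← sq_abs]
      calc _ ≤ (3 / 5 * (1 / 2 : ℝ) ^ i) ^ 2 := by gcongr
        _ = 9 / 25 * (1 / 4) ^ i := by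
            rw [mul_pow, ← pow_mul, mul_comm i 2, pow_mul]; norm_num
    have h6 : Real.pi ^ 2 ≤ 10 := by nlinarith [Real.pi_pos, Real.pi_lt_d2]
    have h7 : Real.pi ^ 2 * ((b (n + i) : ℝ) * (t / scale N (n + i + 1))) ^ 2 ≤
        10 * (9 / 25 * (1 / 4) ^ i) := by gcongr
    linarith
  have hprod : 1 / 5 ≤ ‖∏ i ∈ Finset.range j, D i‖ := by
    rw [norm_prod]
    refine le_trans ?_ (one_sub_sum_le_prod _ (fun i => ‖D i‖) (fun i => 3 / 5 * (1 / 4 : ℝ) ^ i)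
      (fun _ => norm_nonneg _) (fun i => norm_digitSum_le_one _ _) fun i _ => hfac i)
    rw [← Finset.mul_sum, geom_sum_eq (by norm_num)]
    have h1 : (0 : ℝ) ≤ (1 / 4) ^ j := by positivity
    have h2 : 3 / 5 * (((1 / 4 : ℝ) ^ j - 1) / (1 / 4 - 1)) = 4 / 5 - 4 / 5 * (1 / 4) ^ j := by ring
    linarith
  have := norm_sub_norm_le (∏ i ∈ Finset.range j, D i) (∏ i ∈ Finset.range j, mask N B (n + i) t)
  rw [norm_sub_rev] at this
  linarith

lemma power_add (N : ℕ → ℕ) (B : ℕ → Finset ℕ) (n j : ℕ) (ξ : ℝ) :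
    power N B (n + j) ξ = power N B n ξ * ‖∏ i ∈ Finset.range j, mask N B (n + i) ξ‖ ^ 2 := by
  rw [power, Finset.prod_range_add, norm_prod, ← Finset.prod_pow]
  rfl

/-- If the squared Fourier transforms of the finite convolutions converge pointwise to `G`, then
the sums of `G` over the translates of the union of the finite spectra are `1`. -/
theorem hasSum_of_tendsto_power {b N : ℕ → ℕ} {B : ℕ → Finset ℕ} (hb : ∀ k, 0 < b k)
    (hN : ∀ k, 2 ≤ N k) (hbN : ∀ k, b k ∣ N k) (hB : ∀ k, (B k).card = b k)
    (hinj : ∀ k, Set.InjOn (fun x => x % b k) (B k : Set ℕ))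
    (hsum : Summable fun k => ((B k \ Finset.range (b k)).card : ℝ) / b k) {G : ℝ → ℝ}
    (hG : ∀ ξ, Tendsto (fun n => power N B n ξ) atTop (𝓝 (G ξ))) (ξ : ℝ) :
    HasSum (fun l : (⋃ n, (finiteSpectrum b N n : Set ℤ) : Set ℤ) => G (ξ + (l : ℤ))) 1 := by
  set Λ : Set ℤ := ⋃ n, (finiteSpectrum b N n : Set ℤ) with hΛ
  have hbN' : ∀ k, b k ≤ N k := fun k => Nat.le_of_dvd (by have := hN k; omega) (hbN k)
  have hG0 : ∀ t, 0 ≤ G t := fun t => ge_of_tendsto' (hG t) fun n => power_nonneg _ _ _ _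
  have hsub : ∀ n, (finiteSpectrum b N n : Set ℤ) ⊆ Λ := fun n =>
    Set.subset_iUnion (fun n => (finiteSpectrum b N n : Set ℤ)) n
  set F : ℤ → ℝ := Λ.indicator fun l => G (ξ + l) with hF
  have hF0 : ∀ l, 0 ≤ F l := fun l => Set.indicator_nonneg (fun _ _ => hG0 _) l
  set f : ℕ → ℤ → ℝ := fun n l =>
    if l ∈ finiteSpectrum b N n then power N B n (ξ + l) else 0 with hf
  have hf0 : ∀ n l, 0 ≤ f n l := by
    intro n l
    simp only [hf]
    split_ifs
    exacts [power_nonneg _ _ _ _, le_rfl]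
  have hfF : ∀ l, Tendsto (fun n => f n l) atTop (𝓝 (F l)) := by
    intro l
    by_cases hl : l ∈ Λ
    · obtain ⟨m, hm⟩ := Set.mem_iUnion.1 hl
      rw [hF, Set.indicator_of_mem hl]
      refine (hG _).congr' ?_
      filter_upwards [eventually_ge_atTop m] with n hn
      simp only [hf]
      rw [if_pos (finiteSpectrum_mono hb hN hn hm)]
    · rw [hF, Set.indicator_of_notMem hl]
      refine tendsto_const_nhds.congr fun n => ?_
      simp only [hf]
      rw [if_neg fun h : l ∈ finiteSpectrum b N n => hl (hsub n h)]
  have hfsum : ∀ n, HasSum (f n) 1 := by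
    intro n
    rw [← sum_power_finiteSpectrum hb hN hbN hB hinj n ξ, Finset.sum_congr rfl fun (l : ℤ) hl =>
      show power N B n (ξ + l) = f n l by simp only [hf]; rw [if_pos hl]]
    refine hasSum_sum_of_ne_finset_zero fun l hl => ?_
    simp only [hf]
    rw [if_neg hl]
  -- Fatou's argument on finite sums; the dominating function below is a multiple of `F` itself.
  have hFsum : Summable F := by
    refine summable_of_sum_le (c := 1) hF0 fun s => ?_
    exact le_of_tendsto' (tendsto_finsetSum s fun l _ => hfF l) fun n =>
      sum_le_hasSum s (fun _ _ => hf0 _ _) (hfsum n)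
  -- A displaced proportion below `1 / 20` leaves `1 / 5 - 2 / 20 = 1 / 10` for the tail, and
  -- squaring gives `100`. The condition on `ξ` gives `|ξ + l| ≤ (1 / 10 + 1 / 2) * scale N n`.
  have hbound : ∀ᶠ n in atTop, ∀ l, ‖f n l‖ ≤ 100 * F l := by
    have h1 : ∀ᶠ n in atTop, ∑' i,
        ((B (i + n) \ Finset.range (b (i + n))).card : ℝ) / b (i + n) < 1 / 20 :=
      (tendsto_sum_nat_add fun k => ((B k \ Finset.range (b k)).card : ℝ) / b k).eventually_lt_const
        (by norm_num)
    have h2 : ∀ᶠ n : ℕ in atTop, 10 * |ξ| ≤ (2 : ℝ) ^ n :=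
      (tendsto_pow_atTop_atTop_of_one_lt one_lt_two).eventually_ge_atTop _
    filter_upwards [h1, h2] with n h1 h2 l
    rw [Real.norm_of_nonneg (hf0 n l)]
    by_cases hl : l ∈ finiteSpectrum b N n
    · have hl' : l ∈ Λ := hsub n hl
      simp only [hf, hF]
      rw [if_pos hl, Set.indicator_of_mem hl']
      have hsc : (2 : ℝ) ^ n ≤ scale N n := by
        have := two_pow_mul_scale_le hN 0 n
        simp only [scale, Finset.range_zero, Finset.prod_empty, mul_one, zero_add] at this
        exact_mod_cast this
      have habs : |ξ + l| ≤ 3 / 5 * scale N n := by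
        have h3 : 2 * |(l : ℝ)| ≤ scale N n := by
          exact_mod_cast two_mul_abs_le_of_mem_finiteSpectrum hN hl
        linarith [abs_add_le ξ l]
      have hlow : ∀ j, power N B n (ξ + l) ≤ 100 * power N B (n + j) (ξ + l) := by
        intro j
        have h4 := le_norm_prod_mask hb hN hbN' hB n j habs
        have h5 : ∑ i ∈ Finset.range j,
            ((B (n + i) \ Finset.range (b (n + i))).card : ℝ) / b (n + i) ≤ 1 / 20 := by
          refine le_trans ?_ h1.le
          simp only [add_comm n]
          exact ((summable_nat_add_iff n).2 hsum).sum_le_tsum _ fun i _ => by positivity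
        rw [← Finset.mul_sum] at h4
        have h6 : (1 / 10 : ℝ) ≤ ‖∏ i ∈ Finset.range j, mask N B (n + i) (ξ + l)‖ := by linarith
        have h7 : (1 / 10 : ℝ) ^ 2 ≤ ‖∏ i ∈ Finset.range j, mask N B (n + i) (ξ + l)‖ ^ 2 := by
          gcongr
        rw [power_add]
        nlinarith [power_nonneg N B n (ξ + l)]
      refine ge_of_tendsto' (((hG (ξ + l)).comp (tendsto_add_atTop_nat n)).const_mul 100)
        fun j => ?_
      simpa [add_comm n] using hlow j
    · simp only [hf]
      rw [if_neg hl]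
      exact mul_nonneg (by norm_num) (hF0 l)
  have hlim := tendsto_tsum_of_dominated_convergence (hFsum.mul_left 100) hfF hbound
  simp only [fun n => (hfsum n).tsum_eq] at hlim
  have h1 : HasSum F 1 := by
    rw [tendsto_nhds_unique tendsto_const_nhds hlim]
    exact hFsum.hasSum
  exact hasSum_subtype_iff_indicator.2 h1

/-! ### Digit measures and their Fourier transforms -/

lemma coe_scale (N : ℕ → ℕ) (n : ℕ) : (∏ i ∈ Finset.range n, (N i : ℝ)) = scale N n := by
  rw [scale]; push_cast; rfl

lemma digitMeasure_eq {N : ℕ → ℕ} (hN : ∀ k, 2 ≤ N k) (B : ℕ → Finset ℕ) (k : ℕ) :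
    digitMeasure N B k = ((B k).card : ℝ≥0∞)⁻¹ •
      ∑ x ∈ B k, Measure.dirac ((scale N (k + 1) : ℝ)⁻¹ * x) := by
  have hs : (scale N (k + 1) : ℝ) ≠ 0 := by exact_mod_cast (scale_pos hN _).ne'
  have hinj : Function.Injective fun x : ℕ => (scale N (k + 1) : ℝ)⁻¹ * (x : ℝ) := fun x y h => by
    simpa [hs] using h
  rw [digitMeasure, uniformDiscrete, scaledDigits, coe_scale, Finset.card_image_of_injective _ hinj,
    Finset.sum_image hinj.injOn]

lemma isProbabilityMeasure_digitMeasure {N : ℕ → ℕ} (hN : ∀ k, 2 ≤ N k) (B : ℕ → Finset ℕ) (k : ℕ)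
    (hB : (B k).card ≠ 0) : IsProbabilityMeasure (digitMeasure N B k) := by
  constructor
  rw [digitMeasure_eq hN]
  simp only [Measure.smul_apply, Measure.coe_finsetSum, Finset.sum_apply, measure_univ,
    Finset.sum_const, nsmul_eq_mul, mul_one, smul_eq_mul]
  exact ENNReal.inv_mul_cancel (by exact_mod_cast hB) (ENNReal.natCast_ne_top _)

lemma charFun_digitMeasure {N : ℕ → ℕ} (hN : ∀ k, 2 ≤ N k) (B : ℕ → Finset ℕ) (k : ℕ) (ξ : ℝ) :
    charFun (digitMeasure N B k) (2 * Real.pi * ξ) = mask N B k ξ := by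
  rw [charFun_apply_real, digitMeasure_eq hN, integral_smul_measure,
    integral_finsetSum_measure fun x _ => integrable_dirac (by simp), mask, digitSum]
  simp only [integral_dirac, ENNReal.toReal_inv, ENNReal.toReal_natCast, Complex.real_smul]
  push_cast
  congr 1
  refine Finset.sum_congr rfl fun x _ => ?_
  congr 1
  ring

lemma isProbabilityMeasure_finiteConvolution (ρ : ℕ → Measure ℝ)
    [∀ k, IsProbabilityMeasure (ρ k)] (n : ℕ) : IsProbabilityMeasure (finiteConvolution ρ n) := by
  induction n with
  | zero => rw [finiteConvolution]; infer_instance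
  | succ n ih => rw [finiteConvolution]; infer_instance

lemma charFun_finiteConvolution (ρ : ℕ → Measure ℝ) [∀ k, IsProbabilityMeasure (ρ k)] (n : ℕ)
    (t : ℝ) : charFun (finiteConvolution ρ n) t = ∏ k ∈ Finset.range n, charFun (ρ k) t := by
  induction n with
  | zero => simp [finiteConvolution, charFun_dirac]
  | succ n ih =>
    have := isProbabilityMeasure_finiteConvolution ρ n
    rw [finiteConvolution, charFun_conv, ih, Finset.prod_range_succ]

/-- Weak convergence is tested on real functions, so cosine and sine are treated separately. -/
lemma IsInfiniteConvolution.tendsto_charFun {ρ : ℕ → Measure ℝ} [∀ k, IsProbabilityMeasure (ρ k)]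
    {μ : Measure ℝ} (h : IsInfiniteConvolution ρ μ) (t : ℝ) :
    Tendsto (fun n => ∏ k ∈ Finset.range n, charFun (ρ k) t) atTop (𝓝 (charFun μ t)) := by
  have := h.1
  have hsplit : ∀ (ν : Measure ℝ) [IsProbabilityMeasure ν], charFun ν t =
      ((∫ x, Real.cos (t * x) ∂ν : ℝ) : ℂ) + ((∫ x, Real.sin (t * x) ∂ν : ℝ) : ℂ) * Complex.I := by
    intro ν _
    have hc : Integrable (fun x => Real.cos (t * x)) ν :=
      .of_bound (by fun_prop) 1 (ae_of_all _ fun x => Real.abs_cos_le_one _)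
    have hs : Integrable (fun x => Real.sin (t * x)) ν :=
      .of_bound (by fun_prop) 1 (ae_of_all _ fun x => Real.abs_sin_le_one _)
    rw [charFun_apply_real, ← integral_complex_ofReal, ← integral_complex_ofReal,
      ← integral_mul_const, ← integral_add hc.ofReal (hs.ofReal.mul_const _)]
    refine integral_congr_ae (ae_of_all _ fun x => ?_)
    simp only [← Complex.ofReal_mul, Complex.exp_mul_I, Complex.ofReal_cos, Complex.ofReal_sin]
  let c : ℝ →ᵇ ℝ := .ofNormedAddCommGroup (fun x => Real.cos (t * x)) (by fun_prop) 1
    fun x => Real.abs_cos_le_one _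
  let s : ℝ →ᵇ ℝ := .ofNormedAddCommGroup (fun x => Real.sin (t * x)) (by fun_prop) 1
    fun x => Real.abs_sin_le_one _
  have hc : Tendsto (fun n => ∫ x, Real.cos (t * x) ∂finiteConvolution ρ n) atTop
    (𝓝 (∫ x, Real.cos (t * x) ∂μ)) := h.2 c
  have hs : Tendsto (fun n => ∫ x, Real.sin (t * x) ∂finiteConvolution ρ n) atTop
    (𝓝 (∫ x, Real.sin (t * x) ∂μ)) := h.2 s
  rw [hsplit μ]
  refine (((Complex.continuous_ofReal.tendsto _).comp hc).add
    (((Complex.continuous_ofReal.tendsto _).comp hs).mul_const _)).congr fun n => ?_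
  have := isProbabilityMeasure_finiteConvolution ρ n
  rw [← charFun_finiteConvolution, hsplit]
  rfl

namespace IsNearlyConsecutive

variable {b N : ℕ → ℕ} {B : ℕ → Finset ℕ}

lemma card_eq (h : IsNearlyConsecutive b N B) (k : ℕ) : (B k).card = b k := by
  have := (h.1 k).image_eq
  rw [← Finset.coe_image, Finset.coe_inj] at this
  rw [← Finset.card_image_of_injOn (h.1 k).injOn, this, Finset.card_range]

/-- Residues modulo `N k` are below `b k`, and `b k ∣ N k`, so the residue modulo `b k` is the
residue modulo `N k`. -/
lemma injOn_mod (h : IsNearlyConsecutive b N B) (hbN : ∀ k, b k ∣ N k) (k : ℕ) :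
    Set.InjOn (fun x => x % b k) (B k : Set ℕ) := by
  intro x hx y hy hxy
  refine (h.1 k).injOn hx hy ?_
  have h1 := (h.1 k).mapsTo hx
  have h2 := (h.1 k).mapsTo hy
  simp only [Finset.coe_range, Set.mem_Iio] at h1 h2
  change x % N k = y % N k
  rw [← Nat.mod_eq_of_lt h1, ← Nat.mod_eq_of_lt h2, Nat.mod_mod_of_dvd _ (hbN k),
    Nat.mod_mod_of_dvd _ (hbN k)]
  exact hxy

/-- A digit below `b k ≤ N k` scales to at most `(scale N k)⁻¹`, so only displaced digits exceed
this threshold. -/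
lemma digitMeasure_le (h : IsNearlyConsecutive b N B) (hb : ∀ k, 0 < b k) (hbN : ∀ k, b k ≤ N k)
    (hN : ∀ k, 2 ≤ N k) (k : ℕ) :
    digitMeasure N B k {x | (scale N k : ℝ)⁻¹ < |x|} ≤
      ENNReal.ofReal (((B k \ Finset.range (b k)).card : ℝ) / b k) := by
  have hb' : (0 : ℝ) < b k := by exact_mod_cast hb k
  have hm : MeasurableSet {x : ℝ | (scale N k : ℝ)⁻¹ < |x|} :=
    measurableSet_lt measurable_const continuous_abs.measurable
  rw [digitMeasure_eq hN, h.card_eq, Measure.smul_apply, Measure.coe_finsetSum, Finset.sum_apply,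
    ENNReal.ofReal_div_of_pos hb', ENNReal.ofReal_natCast, ENNReal.ofReal_natCast, smul_eq_mul,
    mul_comm, ENNReal.div_eq_inv_mul, mul_comm]
  gcongr
  calc ∑ x ∈ B k, Measure.dirac ((scale N (k + 1) : ℝ)⁻¹ * x) {x | (scale N k : ℝ)⁻¹ < |x|}
      ≤ ∑ x ∈ B k, if x ∈ Finset.range (b k) then 0 else 1 := by
        refine Finset.sum_le_sum fun x _ => ?_
        split_ifs with hx
        · rw [Measure.dirac_apply' _ hm, Set.indicator_of_notMem]
          have hs : (0 : ℝ) < scale N k := by exact_mod_cast scale_pos hN k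
          have hNk : (0 : ℝ) < N k := by have := hN k; positivity
          have hxN : (x : ℝ) ≤ N k := by
            exact_mod_cast (Finset.mem_range.1 hx).le.trans (hbN k)
          simp only [Set.mem_ofPred_eq, not_lt, scale_succ, Nat.cast_mul]
          rw [abs_of_nonneg (by positivity), mul_inv, mul_assoc]
          refine mul_le_of_le_one_right (by positivity) ?_
          rw [inv_mul_le_iff₀ hNk, mul_one]
          exact hxN
        · exact prob_le_one
    _ = ((B k \ Finset.range (b k)).card : ℝ≥0∞) := by
        rw [Finset.sum_ite, Finset.sum_const_zero, zero_add, Finset.sum_const, nsmul_one,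
          Finset.filter_notMem_eq_sdiff]

end IsNearlyConsecutive

/-! ### Spectrality of the infinite convolution -/

/-- The infinite convolution generated by nearly consecutive digit sets exists and is spectral. -/
theorem IsAdmissible.exists_isSpectralMeasure {b N : ℕ → ℕ} {B : ℕ → Finset ℕ}
    (h : IsAdmissible b N) (hB : IsNearlyConsecutive b N B) :
    ∃ μ : Measure ℝ, IsInfiniteConvolution (digitMeasure N B) μ ∧ IsSpectralMeasure μ ∧
      ∀ (k : ℕ) (R : ℝ), digitMeasure N B k (Set.Ici R) ≤ μ (Set.Ici R) := by
  have hb : ∀ k, 0 < b k := fun k => by have := (h k).1; omega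
  have hN : ∀ k, 2 ≤ N k := fun k => (h k).1.trans (h k).2.1
  have hcard : ∀ k, (B k).card ≠ 0 := fun k => by rw [hB.card_eq]; exact (hb k).ne'
  have : ∀ k, IsProbabilityMeasure (digitMeasure N B k) := fun k =>
    isProbabilityMeasure_digitMeasure hN B k (hcard k)
  have hc : Summable fun k => (scale N k : ℝ)⁻¹ := by
    refine .of_nonneg_of_le (fun k => by positivity) (fun k => ?_)
      (summable_geometric_of_lt_one (r := 1 / 2) (by norm_num) (by norm_num))
    have h1 := two_pow_mul_scale_le hN 0 k
    simp only [scale, Finset.range_zero, Finset.prod_empty, mul_one, zero_add] at h1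
    rw [one_div, inv_pow]
    have h2 : (2 : ℝ) ^ k ≤ scale N k := by exact_mod_cast h1
    gcongr
  have htail : ∑' k, digitMeasure N B k {x | (scale N k : ℝ)⁻¹ < |x|} ≠ ∞ := by
    refine ne_top_of_le_ne_top ?_ (ENNReal.tsum_le_tsum fun k =>
      hB.digitMeasure_le hb (fun k => (h k).2.1) hN k)
    rw [← ENNReal.ofReal_tsum_of_nonneg (fun k => by positivity) hB.2]
    exact ENNReal.ofReal_ne_top
  obtain ⟨μ, hμ, hle⟩ := exists_isInfiniteConvolution (digitMeasure N B) _ hc htail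
  have hprob := hμ.1
  refine ⟨μ, hμ, ⟨hprob, _, isSpectrum_of_hasSum μ
    ((fun l : ℤ => (l : ℝ)) '' ⋃ n, (finiteSpectrum b N n : Set ℤ))
    ((Set.to_countable _).image _) fun ξ => ?_⟩, hle fun k => ?_⟩
  · rw [← (Equiv.Set.image (fun l : ℤ => (l : ℝ)) (⋃ n, (finiteSpectrum b N n : Set ℤ))
      Int.cast_injective).hasSum_iff]
    refine hasSum_of_tendsto_power (G := fun t => ‖charFun μ (2 * Real.pi * t)‖ ^ 2) hb hN
      (fun k => (h k).2.2) hB.card_eq (hB.injOn_mod fun k => (h k).2.2) hB.2 (fun t => ?_) ξ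
    refine ((hμ.tendsto_charFun (2 * Real.pi * t)).norm.pow 2).congr fun n => ?_
    simp only [charFun_digitMeasure hN, norm_prod, power, Finset.prod_pow]
  · rw [digitMeasure_eq hN]
    refine Measure.ae_smul_measure ?_ _
    rw [ae_iff, Measure.coe_finsetSum, Finset.sum_apply]
    refine Finset.sum_eq_zero fun x _ => ?_
    have hm : MeasurableSet {a : ℝ | ¬0 ≤ a} :=
      (measurableSet_le measurable_const measurable_id).compl
    rw [Measure.dirac_apply' _ hm]
    refine Set.indicator_of_notMem ?_ _
    simp only [Set.mem_ofPred_eq, not_not]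
    positivity

/-! ### An example with non-compact support -/

/-- The moduli `2 ^ (k + 1)` of a nearly consecutive sequence with unbounded infinite
convolution. -/
def dyadicModulus (k : ℕ) : ℕ := 2 ^ (k + 1)

/-- A digit that is congruent to `2 ^ (k + 1) - 1` and large compared with the scale. -/
def farDigit (k : ℕ) : ℕ :=
  dyadicModulus k - 1 + dyadicModulus k * (scale dyadicModulus (k + 1) * k)

/-- Consecutive digits with the last one replaced by `farDigit k`. -/
def farDigits (k : ℕ) : Finset ℕ := insert (farDigit k) (Finset.range (dyadicModulus k - 1))

lemma two_le_dyadicModulus (k : ℕ) : 2 ≤ dyadicModulus k := by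
  rw [dyadicModulus, pow_succ]
  have := Nat.one_le_two_pow (n := k)
  omega

lemma isAdmissible_dyadicModulus : IsAdmissible dyadicModulus dyadicModulus :=
  fun k => ⟨two_le_dyadicModulus k, le_rfl, dvd_rfl⟩

lemma farDigit_mod (k : ℕ) : farDigit k % dyadicModulus k = dyadicModulus k - 1 := by
  have := two_le_dyadicModulus k
  rw [farDigit, Nat.add_mul_mod_self_left, Nat.mod_eq_of_lt (by omega)]

lemma isNearlyConsecutive_farDigits :
    IsNearlyConsecutive dyadicModulus dyadicModulus farDigits := by
  refine ⟨fun k => ?_, ?_⟩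
  · have h2 := two_le_dyadicModulus k
    have hfar := farDigit_mod k
    have hmem : ∀ x, x ∈ (farDigits k : Set ℕ) ↔ x = farDigit k ∨ x < dyadicModulus k - 1 := by
      intro x
      simp [farDigits]
    have hlow : ∀ x, x < dyadicModulus k - 1 → x % dyadicModulus k = x := fun x hx =>
      Nat.mod_eq_of_lt (by omega)
    refine ⟨fun x _ => ?_, fun x hx y hy hxy => ?_, fun y hy => ?_⟩
    · simpa using Nat.mod_lt x (by omega)
    · replace hxy : x % dyadicModulus k = y % dyadicModulus k := hxy
      rcases (hmem x).1 hx with rfl | hx <;> rcases (hmem y).1 hy with rfl | hy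
      · rfl
      · rw [hfar, hlow y hy] at hxy; omega
      · rw [hfar, hlow x hx] at hxy; omega
      · rwa [hlow x hx, hlow y hy] at hxy
    · have hy' : y < dyadicModulus k := by simpa using hy
      rcases Nat.lt_or_ge y (dyadicModulus k - 1) with h | h
      · exact ⟨y, (hmem y).2 (Or.inr h), hlow y h⟩
      · exact ⟨farDigit k, (hmem _).2 (Or.inl rfl), by simp only [hfar]; omega⟩
  -- At most one digit per level is displaced, so the growth of the moduli alone gives summability.
  · refine .of_nonneg_of_le (fun k => by positivity) (fun k => ?_)
      (summable_geometric_of_lt_one (r := 1 / 2) (by norm_num) (by norm_num))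
    have hsub : farDigits k \ Finset.range (dyadicModulus k) ⊆ {farDigit k} := by
      intro x hx
      simp only [farDigits, Finset.mem_sdiff, Finset.mem_insert, Finset.mem_range] at hx
      rw [Finset.mem_singleton]
      omega
    have hcard : ((farDigits k \ Finset.range (dyadicModulus k)).card : ℝ) ≤ 1 := by
      exact_mod_cast (Finset.card_le_card hsub).trans (by simp)
    have hpow : (2 : ℝ) ^ k ≤ dyadicModulus k := by
      exact_mod_cast Nat.pow_le_pow_right two_pos (Nat.le_succ k)
    rw [one_div, inv_pow, ← one_div]
    gcongr

/-- The atom at the scaled `farDigit k` lies at or beyond `k`. All digits being nonnegative, the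
infinite convolution inherits this mass. -/
lemma digitMeasure_farDigits_pos (k : ℕ) :
    0 < digitMeasure dyadicModulus farDigits k (Set.Ici (k : ℝ)) := by
  have hs : (0 : ℝ) < scale dyadicModulus (k + 1) := by
    exact_mod_cast scale_pos two_le_dyadicModulus _
  have hmem : (scale dyadicModulus (k + 1) : ℝ)⁻¹ * farDigit k ∈ Set.Ici (k : ℝ) := by
    rw [Set.mem_Ici, le_inv_mul_iff₀ hs]
    have h1 : scale dyadicModulus (k + 1) * k ≤ farDigit k :=
      (Nat.le_mul_of_pos_left _ (by have := two_le_dyadicModulus k; omega)).trans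
        (Nat.le_add_left _ _)
    exact_mod_cast h1
  rw [digitMeasure_eq two_le_dyadicModulus, Measure.smul_apply, Measure.coe_finsetSum,
    Finset.sum_apply, smul_eq_mul]
  refine ENNReal.mul_pos (ENNReal.inv_ne_zero.2 (ENNReal.natCast_ne_top _)) (ne_of_gt ?_)
  have h1 := Finset.single_le_sum (f := fun x : ℕ =>
    Measure.dirac ((scale dyadicModulus (k + 1) : ℝ)⁻¹ * x) (Set.Ici (k : ℝ)))
    (fun _ _ => zero_le) (Finset.mem_insert_self (farDigit k)
      (Finset.range (dyadicModulus k - 1)))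
  refine lt_of_lt_of_le ?_ h1
  simp only [Measure.dirac_apply_of_mem hmem, zero_lt_one]

lemma not_isCompact_support_of_forall_pos {μ : Measure ℝ}
    (h : ∀ n : ℕ, 0 < μ (Set.Ici (n : ℝ))) : ¬ IsCompact μ.support := by
  intro hc
  obtain ⟨R, hR⟩ := hc.bddAbove
  obtain ⟨n, hn⟩ := exists_nat_gt R
  have hsub : Set.Ici (n : ℝ) ⊆ μ.supportᶜ := fun x hx hmem =>
    absurd (hR hmem) (not_le.2 (hn.trans_le hx))
  exact (h n).ne' (measure_mono_null hsub Measure.measure_compl_support)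

theorem theorem1p4 :
    (∀ (b N : ℕ → ℕ) (B : ℕ → Finset ℕ), IsAdmissible b N → IsNearlyConsecutive b N B →
      ∃ μ : Measure ℝ, IsInfiniteConvolution (digitMeasure N B) μ ∧ IsSpectralMeasure μ) ∧
    (∃ (b N : ℕ → ℕ) (B : ℕ → Finset ℕ), IsAdmissible b N ∧ IsNearlyConsecutive b N B ∧
      ∃ μ : Measure ℝ, IsInfiniteConvolution (digitMeasure N B) μ ∧ IsSpectralMeasure μ ∧
        ¬ IsCompact μ.support) := by
  refine ⟨fun b N B h hB => ?_, dyadicModulus, dyadicModulus, farDigits,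
    isAdmissible_dyadicModulus, isNearlyConsecutive_farDigits, ?_⟩
  · obtain ⟨μ, h1, h2, -⟩ := h.exists_isSpectralMeasure hB
    exact ⟨μ, h1, h2⟩
  · obtain ⟨μ, h1, h2, h3⟩ :=
      isAdmissible_dyadicModulus.exists_isSpectralMeasure isNearlyConsecutive_farDigits
    exact ⟨μ, h1, h2, not_isCompact_support_of_forall_pos fun n =>
      (digitMeasure_farDigits_pos n).trans_le (h3 n n)⟩
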